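/- For $n\ge 0$ let $D_n(x)=\sum_{k=0}^n\binom nk^2x^k(x+1)^{n-k}$, and for $n\ge 1$ let $s_n(x)=\sum_{k=1}^n N(n,k)\,x^{k-1}(x+1)^{n-k}$ with the Narayana numbers $N(n,k)=\frac1n\binom nk\binom n{k-1}$. Let $C_k=\frac1{k+1}\binom{2k}k$ be the Catalan numbers. (i) For every integer $n\ge 1$ one has the polynomial identity $$\frac1n\sum_{k=0}^{n-1}D_k(x)s_{k+1}(x)=W_n(x(x+1)),\qquad W_n(x)=\sum_{k=1}^n w(n,k)C_{k-1}x^{k-1},$$ where $w(n,k)=\frac1k\binom{n-1}{k-1}\binom{n+k}{k-1}$ is an integer for every $k\ge 1$, and $W_n(x)\in\mathbb Z[x]$. In particular, $\frac1n\sum_{k=0}^{n-1}D_k(x)s_{k+1}(x)\in\mathbb Z[x(x+1)]$. (ii) Let $p$ be an odd prime and $x\in\mathbb Z_p$ a $p$-adic integer. If $x\equiv 0$ or $x\equiv -1\pmod p$, then $$\sum_{k=0}^{p-1}D_k(x)s_{k+1}(x)\equiv p\,(1-x(x+1))\pmod{p^3}.$$ Otherwise, $$\sum_{k=0}^{p-1}D_k(x)s_{k+1}(x)\equiv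 2p^2+\frac{2x+1}{x(x+1)}\,p^2\left(x^2q_p(x)-(x+1)^2q_p(x+1)\right)\pmod{p^3},$$ where $q_p(z)=(z^{p-1}-1)/p$ is the Fermat quotient of a $p$-adic integer $z\not\equiv 0\pmod p$; in particular, in this case $\sum_{k=0}^{p-1}D_k(x)s_{k+1}(x)\equiv 0\pmod{p^2}$. -/

import Mathlib

open Polynomial

noncomputable section

/-- The Narayana number `N(n,k) = (1/n) C(n,k) C(n,k-1)`, used for `n, k ≥ 1`. -/
def narayana (n k : ℕ) : ℚ :=
  (1 / (n : ℚ)) * (n.choose k : ℚ) * (n.choose (k - 1) : ℚ)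

/-- The central Delannoy polynomial `D_n(x) = ∑_{k=0}^n C(n,k)^2 x^k (x+1)^{n-k}`. -/
def delannoyPoly (n : ℕ) : ℚ[X] :=
  ∑ k ∈ Finset.Icc 0 n, C ((n.choose k : ℚ) ^ 2) * X ^ k * (X + 1) ^ (n - k)

/-- The little Schröder polynomial `s_n(x) = ∑_{k=1}^n N(n,k) x^{k-1} (x+1)^{n-k}`, `n ≥ 1`. -/
def schroederPoly (n : ℕ) : ℚ[X] :=
  ∑ k ∈ Finset.Icc 1 n, C (narayana n k) * X ^ (k - 1) * (X + 1) ^ (n - k)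

/-- The number `w(n,k) = (1/k) C(n-1,k-1) C(n+k,k-1)`, used for `n, k ≥ 1`. -/
def wNum (n k : ℕ) : ℚ :=
  (1 / (k : ℚ)) * ((n - 1).choose (k - 1) : ℚ) * ((n + k).choose (k - 1) : ℚ)

/-- The polynomial `W_n(x) = ∑_{k=1}^n w(n,k) C_{k-1} x^{k-1}`, with `C_j` the Catalan numbers. -/
def wPoly (n : ℕ) : ℚ[X] :=
  ∑ k ∈ Finset.Icc 1 n, C (wNum n k * (catalan (k - 1) : ℚ)) * X ^ (k - 1)

/-- The Fermat quotient `q_p(z) = (z^{p-1} - 1) / p` of a `p`-adic integer `z`, as an element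
of `ℚ_p`; it is a `p`-adic integer when `p` does not divide `z`. -/
def fermatQuotient (p : ℕ) [Fact p.Prime] (z : ℤ_[p]) : ℚ_[p] :=
  ((z : ℚ_[p]) ^ (p - 1) - 1) / (p : ℚ_[p])

/-- `a ≡ b (mod p^m)`, that is `a - b ∈ p^m ℤ_p`, for elements of `ℚ_p`. -/
def PadicModEq (p : ℕ) [Fact p.Prime] (m : ℕ) (a b : ℚ_[p]) : Prop :=
  ∃ z : ℤ_[p], a - b = (p : ℚ_[p]) ^ m * (z : ℚ_[p])

/-- The value at the `p`-adic integer `x` of `∑_{k=0}^{p-1} D_k(x) s_{k+1}(x)`. -/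
def delannoySchroederSum (p : ℕ) [Fact p.Prime] (x : ℤ_[p]) : ℚ_[p] :=
  ∑ k ∈ Finset.range p,
    aeval (x : ℚ_[p]) (delannoyPoly k) * aeval (x : ℚ_[p]) (schroederPoly (k + 1))

end

/-! Put y = x(x+1). The pair (D_n, n·s_n) satisfies a first-order linear system over ℚ[x] with
coefficients 2x+1, y and constants. Since (2x+1)² = 1+4y, the three quantities D_n²,
(2x+1)·D_n·n·s_n and (n·s_n)² satisfy a system over ℚ[y], which explicit hypergeometric coefficients
solve (`delannoy_schroeder_quadratic`). The recurrence for s_{n+1} then writes (n+2)·D_n·s_{n+1}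
through the first two, and comparing coefficients gives D_n·s_{n+1} = (n+1)W_{n+1}(y) − n·W_n(y), so
the sum telescopes.

For n = p the sum is p·W_p(y), so it suffices to know W_p(y) mod p². There w(p,k+1) = (−1)^k(1 − p +
p/(k+1)) for k < p−1, so W_p(y) reduces to P = ∑ C_k(−y)^k and M = ∑ (p/(k+1))·C_k(−y)^k over k <
p−1, plus a top term. P is a truncation of the Catalan series, whose value at −y is 1/(x+1), and its
remainder is explicit (`succ_mul_sum_catalan`). M comes from expanding (x+1)^p − x^p in powers of y
(`pow_sub_pow_eq_sum_catalan`). If p divides y, only the two lowest terms of W_p(y) survive. -/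

/-! ### Linear recurrences, by comparing coefficients of x^k(x+1)^(n-k) -/

/-- The polynomial `∑_{k ≤ n} f k * x^k * (x+1)^(n-k)`. -/
noncomputable def bernsteinSum (n : ℕ) (f : ℕ → ℚ) : ℚ[X] :=
  ∑ k ∈ Finset.range (n + 1), C (f k) * X ^ k * (X + 1) ^ (n - k)

theorem X_add_one_mul_bernsteinSum (n : ℕ) (f : ℕ → ℚ) (hf : f (n + 1) = 0) :
    (X + 1) * bernsteinSum n f = bernsteinSum (n + 1) f := by
  unfold bernsteinSum
  rw [Finset.sum_range_succ _ (n + 1), hf, Finset.mul_sum]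
  simp only [map_zero, zero_mul, add_zero]
  refine Finset.sum_congr rfl fun k hk => ?_
  have : n + 1 - k = (n - k) + 1 := by have := Finset.mem_range.1 hk; omega
  rw [this, pow_succ]; ring

/-- The sequence `0, f 0, f 1, …`. -/
def shiftSeq (f : ℕ → ℚ) : ℕ → ℚ
  | 0 => 0
  | k + 1 => f k

theorem X_mul_bernsteinSum (n : ℕ) (f : ℕ → ℚ) :
    X * bernsteinSum n f = bernsteinSum (n + 1) (shiftSeq f) := by
  unfold bernsteinSum
  rw [Finset.sum_range_succ' _ (n + 1), Finset.mul_sum]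
  simp only [shiftSeq, map_zero, zero_mul, add_zero]
  refine Finset.sum_congr rfl fun k hk => ?_
  rw [Nat.add_sub_add_right]; ring

theorem bernsteinSum_add (n : ℕ) (f g : ℕ → ℚ) :
    bernsteinSum n f + bernsteinSum n g = bernsteinSum n (fun k => f k + g k) := by
  simp only [bernsteinSum, ← Finset.sum_add_distrib, map_add, add_mul]

theorem C_mul_bernsteinSum (n : ℕ) (c : ℚ) (f : ℕ → ℚ) :
    C c * bernsteinSum n f = bernsteinSum n (fun k => c * f k) := by
  simp only [bernsteinSum, Finset.mul_sum, map_mul, mul_assoc]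

theorem delannoyPoly_eq_bernsteinSum (n : ℕ) :
    delannoyPoly n = bernsteinSum n (fun k => (n.choose k : ℚ) ^ 2) := by
  rw [delannoyPoly, bernsteinSum, ← Nat.range_succ_eq_Icc_zero]

theorem schroederPoly_succ_eq_bernsteinSum (n : ℕ) :
    schroederPoly (n + 1) = bernsteinSum n (fun k => narayana (n + 1) (k + 1)) := by
  rw [schroederPoly, bernsteinSum, Finset.range_eq_Ico, ← Finset.Ico_add_one_right_eq_Icc,
    ← Finset.sum_Ico_add' _ 0 (n + 1) 1]
  refine Finset.sum_congr rfl fun k _ => ?_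
  rw [Nat.add_sub_cancel, Nat.add_sub_add_right]

theorem schroederPoly_zero : schroederPoly 0 = 0 := by simp [schroederPoly]

/-- Square Pascal's rule: the squares come from 2x+1 = x + (x+1), and the cross term
2·C(n,k)·C(n,k-1) is 2n·N(n,k). -/
theorem delannoyPoly_succ (n : ℕ) :
    delannoyPoly (n + 1) =
      (2 * X + 1) * delannoyPoly n + 2 * (X * (X + 1)) * (C (n : ℚ) * schroederPoly n) := by
  rcases n with _ | m
  · simp [delannoyPoly, schroederPoly_zero, Finset.sum_Icc_succ_top]
    ring
  · have e : (2 * X + 1) * delannoyPoly (m + 1)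
        + 2 * (X * (X + 1)) * (C ((m + 1 : ℕ) : ℚ) * schroederPoly (m + 1))
        = X * delannoyPoly (m + 1) + (X + 1) * delannoyPoly (m + 1)
          + (X + 1) * (X * (C (2 * ((m + 1 : ℕ) : ℚ)) * schroederPoly (m + 1))) := by
      simp only [map_mul, map_ofNat]; ring
    rw [e, schroederPoly_succ_eq_bernsteinSum, C_mul_bernsteinSum,
      delannoyPoly_eq_bernsteinSum, delannoyPoly_eq_bernsteinSum,
      X_mul_bernsteinSum, X_mul_bernsteinSum,
      X_add_one_mul_bernsteinSum, X_add_one_mul_bernsteinSum, bernsteinSum_add, bernsteinSum_add]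
    · congr 1
      funext k
      rcases k with _ | k
      · simp [shiftSeq]
      · have h : ((m : ℚ) + 1) ≠ 0 := by positivity
        simp only [shiftSeq, Nat.choose_succ_succ (m + 1) k, narayana, Nat.add_sub_cancel]
        push_cast
        field_simp
        ring
    · simp [shiftSeq, narayana]
    · simp

theorem schroederPoly_succ (n : ℕ) :
    C ((n : ℚ) + 2) * schroederPoly (n + 1) =
      (2 * X + 1) * (C (n : ℚ) * schroederPoly n) + 2 * delannoyPoly n := by
  rcases n with _ | m
  · simp [delannoyPoly, schroederPoly, narayana, map_ofNat]
  · have e : (2 * X + 1) * (C ((m + 1 : ℕ) : ℚ) * schroederPoly (m + 1))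
          + 2 * delannoyPoly (m + 1)
        = X * (C ((m + 1 : ℕ) : ℚ) * schroederPoly (m + 1))
          + (X + 1) * (C ((m + 1 : ℕ) : ℚ) * schroederPoly (m + 1))
          + C 2 * delannoyPoly (m + 1) := by
      simp only [map_ofNat]; ring
    rw [e, schroederPoly_succ_eq_bernsteinSum, schroederPoly_succ_eq_bernsteinSum,
      delannoyPoly_eq_bernsteinSum, C_mul_bernsteinSum, C_mul_bernsteinSum, C_mul_bernsteinSum,
      X_mul_bernsteinSum,
      X_add_one_mul_bernsteinSum, bernsteinSum_add, bernsteinSum_add]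
    · congr 1
      funext k
      have h : ((m : ℚ) + 1) ≠ 0 := by positivity
      have h' : ((m : ℚ) + 2) ≠ 0 := by positivity
      rcases k with _ | k
      · simp [shiftSeq, narayana]
        field_simp
      -- The binomials in N(m+2,k+2) are rewritten so that the factors 1/(m+2) and m+3 cancel.
      · have h1 : ((m : ℚ) + 2) * ((m + 1).choose (k + 1) : ℚ)
            = ((m + 2).choose (k + 2) : ℚ) * (k + 2) := by
          exact_mod_cast Nat.add_one_mul_choose_eq (m + 1) (k + 1)
        have h2 : ((m : ℚ) + 3) * ((m + 2).choose (k + 1) : ℚ)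
            = ((m + 3).choose (k + 2) : ℚ) * (k + 2) := by
          exact_mod_cast Nat.add_one_mul_choose_eq (m + 2) (k + 1)
        have h3 : ((m + 3).choose (k + 2) : ℚ) = ((m + 1).choose k : ℚ)
            + 2 * ((m + 1).choose (k + 1) : ℚ) + ((m + 1).choose (k + 2) : ℚ) := by
          rw [Nat.choose_succ_succ (m + 2) (k + 1), Nat.choose_succ_succ (m + 1) k,
            Nat.choose_succ_succ (m + 1) (k + 1)]
          push_cast; ring
        have hk : ((k : ℚ) + 2) ≠ 0 := by positivity
        have h4 : ((m + 2).choose (k + 2) : ℚ)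
            = ((m : ℚ) + 2) * ((m + 1).choose (k + 1) : ℚ) / (k + 2) := by
          field_simp; linear_combination -h1
        have h5 : ((m + 2).choose (k + 1) : ℚ)
            = ((m + 3).choose (k + 2) : ℚ) * (k + 2) / (m + 3) := by
          field_simp; linear_combination h2
        simp only [shiftSeq, narayana, Nat.add_sub_cancel]
        have e1 : m + 1 + 1 = m + 2 := rfl
        have e2 : k + 1 + 1 = k + 2 := rfl
        rw [e1, e2, h4, h5, h3]
        push_cast
        have h6 : ((m : ℚ) + 1 + 1) ≠ 0 := by positivity
        field_simp
        ring
    · simp [narayana]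

/-! ### Quadratic expressions in D_n and s_n as polynomials in x(x+1) -/

/-- The coefficient `C(n+k,2k) C(2k,k)^2` of `(x(x+1))^k` in `D_n(x)^2`, as a product that is
polynomial in `n`. -/
noncomputable def delannoySqCoeff (n k : ℕ) : ℚ :=
  ∏ i ∈ Finset.range k, 2 * (2 * (i : ℚ) + 1) * (n + 1 + i) * (n - i) / (i + 1) ^ 3

theorem delannoySqCoeff_zero (n : ℕ) : delannoySqCoeff n 0 = 1 := by simp [delannoySqCoeff]

theorem delannoySqCoeff_succ (n k : ℕ) : delannoySqCoeff n (k + 1) =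
    delannoySqCoeff n k * (2 * (2 * (k : ℚ) + 1) * (n + 1 + k) * (n - k) / (k + 1) ^ 3) := by
  rw [delannoySqCoeff, Finset.prod_range_succ, ← delannoySqCoeff]

theorem delannoySqCoeff_eq_zero {n k : ℕ} (h : n < k) : delannoySqCoeff n k = 0 :=
  Finset.prod_eq_zero (Finset.mem_range.2 h) (by simp)

/-- With the ratio in k, this diagonal ratio turns each coefficient recurrence below into a
rational-function identity in n and k. -/
theorem delannoySqCoeff_succ_succ (n k : ℕ) : delannoySqCoeff (n + 1) (k + 1) =
    delannoySqCoeff n k * (2 * (2 * (k : ℚ) + 1) * (n + 1 + k) * (n + 2 + k) / (k + 1) ^ 3) := by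
  induction k with
  | zero =>
    rw [delannoySqCoeff_succ, delannoySqCoeff_zero, delannoySqCoeff_zero]
    push_cast; ring
  | succ k ih =>
    rw [delannoySqCoeff_succ, ih, delannoySqCoeff_succ n k]
    push_cast
    have : (k : ℚ) + 1 ≠ 0 := by positivity
    have : (k : ℚ) + 1 + 1 ≠ 0 := by positivity
    field_simp
    ring

/-- The coefficients of `n (2x+1) D_n(x) s_n(x)` in powers of `x(x+1)`. -/
noncomputable def crossCoeff (n k : ℕ) : ℚ :=
  ((k + 1) * delannoySqCoeff n (k + 1) + 4 * k * delannoySqCoeff n k) / (2 * (n + 1))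

/-- The coefficients of `(n s_n(x))^2` in powers of `x(x+1)`. -/
noncomputable def schroederSqCoeff (n k : ℕ) : ℚ :=
  n / (n + 1) * ((k + 1) / (k + 2)) * delannoySqCoeff n (k + 1)

/-- The polynomial with coefficients `f 0, …, f n`. -/
noncomputable def polyOfCoeffs (n : ℕ) (f : ℕ → ℚ) : ℚ[X] :=
  ∑ k ∈ Finset.range (n + 1), monomial k (f k)

theorem coeff_polyOfCoeffs {n : ℕ} {f : ℕ → ℚ} (hf : ∀ k, n < k → f k = 0) (k : ℕ) :
    (polyOfCoeffs n f).coeff k = f k := by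
  simp only [polyOfCoeffs, finsetSum_coeff, coeff_monomial, Finset.sum_ite_eq', Finset.mem_range]
  split_ifs with h
  · rfl
  · exact (hf k (by omega)).symm

/-- `D_n(x)^2` as a polynomial in `x(x+1)`. -/
noncomputable def delannoySqPoly (n : ℕ) : ℚ[X] := polyOfCoeffs n (delannoySqCoeff n)

/-- `n (2x+1) D_n(x) s_n(x)` as a polynomial in `x(x+1)`. -/
noncomputable def crossPoly (n : ℕ) : ℚ[X] := polyOfCoeffs n (crossCoeff n)

/-- `(n s_n(x))^2` as a polynomial in `x(x+1)`. -/
noncomputable def schroederSqPoly (n : ℕ) : ℚ[X] := polyOfCoeffs n (schroederSqCoeff n)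

theorem coeff_delannoySqPoly (n k : ℕ) : (delannoySqPoly n).coeff k = delannoySqCoeff n k :=
  coeff_polyOfCoeffs (fun _ => delannoySqCoeff_eq_zero) k

theorem coeff_crossPoly (n k : ℕ) : (crossPoly n).coeff k = crossCoeff n k :=
  coeff_polyOfCoeffs (fun k h => by
    simp [crossCoeff, delannoySqCoeff_eq_zero h,
      delannoySqCoeff_eq_zero (Nat.lt_succ_of_lt h)]) k

theorem coeff_schroederSqPoly (n k : ℕ) : (schroederSqPoly n).coeff k = schroederSqCoeff n k :=
  coeff_polyOfCoeffs (fun k h => by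
    simp [schroederSqCoeff, delannoySqCoeff_eq_zero (Nat.lt_succ_of_lt h)]) k

theorem delannoySqPoly_succ (n : ℕ) : delannoySqPoly (n + 1) =
    delannoySqPoly n + C 4 * (X * delannoySqPoly n) + C 4 * (X * crossPoly n)
      + C 4 * (X * (X * schroederSqPoly n)) := by
  ext k
  rcases k with _ | _ | k <;>
  simp only [coeff_add, coeff_C_mul, coeff_X_mul, coeff_X_mul_zero, coeff_delannoySqPoly,
    coeff_crossPoly, coeff_schroederSqPoly, crossCoeff, schroederSqCoeff,
    delannoySqCoeff_succ_succ, delannoySqCoeff_succ n, delannoySqCoeff_zero]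
  · ring
  · push_cast
    field_simp
    ring
  · push_cast
    field_simp
    ring

theorem crossPoly_succ (n : ℕ) : C ((n : ℚ) + 2) * crossPoly (n + 1) =
    C ((n : ℚ) + 1) * (crossPoly n + C 8 * (X * crossPoly n) + C 2 * delannoySqPoly n
      + C 8 * (X * delannoySqPoly n) + C 2 * (X * schroederSqPoly n)
      + C 8 * (X * (X * schroederSqPoly n))) := by
  ext k
  rcases k with _ | _ | k <;>
  simp only [coeff_add, coeff_C_mul, coeff_X_mul, coeff_X_mul_zero, coeff_delannoySqPoly,
    coeff_crossPoly, coeff_schroederSqPoly, crossCoeff, schroederSqCoeff,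
    delannoySqCoeff_succ_succ, delannoySqCoeff_succ n, delannoySqCoeff_zero]
  · push_cast
    have : (n : ℚ) + 1 + 1 ≠ 0 := by positivity
    field_simp
    ring
  · push_cast
    have : (n : ℚ) + 1 + 1 ≠ 0 := by positivity
    field_simp
    ring
  · push_cast
    have : (n : ℚ) + 1 + 1 ≠ 0 := by positivity
    field_simp
    ring

theorem schroederSqPoly_succ (n : ℕ) : C (((n : ℚ) + 2) ^ 2) * schroederSqPoly (n + 1) =
    C (((n : ℚ) + 1) ^ 2) * (schroederSqPoly n + C 4 * (X * schroederSqPoly n)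
      + C 4 * crossPoly n + C 4 * delannoySqPoly n) := by
  ext k
  rcases k with _ | k <;>
  simp only [coeff_add, coeff_C_mul, coeff_X_mul, coeff_X_mul_zero, coeff_delannoySqPoly,
    coeff_crossPoly, coeff_schroederSqPoly, crossCoeff, schroederSqCoeff,
    delannoySqCoeff_succ_succ, delannoySqCoeff_succ n, delannoySqCoeff_zero]
  · push_cast
    have : (n : ℚ) + 1 + 1 ≠ 0 := by positivity
    field_simp
    ring
  · push_cast
    have : (n : ℚ) + 1 + 1 ≠ 0 := by positivity
    field_simp
    ring

/-- The three identities must be carried together: squaring and multiplying the linear recurrences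
mixes them, and (2x+1)² = 1 + 4x(x+1) keeps the system inside polynomials in x(x+1). -/
theorem delannoy_schroeder_quadratic (n : ℕ) :
    delannoyPoly n ^ 2 = (delannoySqPoly n).comp (X * (X + 1)) ∧
    (2 * X + 1) * delannoyPoly n * (C (n : ℚ) * schroederPoly n)
      = (crossPoly n).comp (X * (X + 1)) ∧
    (C (n : ℚ) * schroederPoly n) ^ 2 = (schroederSqPoly n).comp (X * (X + 1)) := by
  induction n with
  | zero =>
    simp [delannoyPoly, schroederPoly_zero, delannoySqPoly, crossPoly, schroederSqPoly,
      polyOfCoeffs, crossCoeff, schroederSqCoeff, delannoySqCoeff_zero, delannoySqCoeff_succ]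
  | succ n ih =>
    obtain ⟨hA, hB, hE⟩ := ih
    have h2 : C ((n : ℚ) + 2) ≠ 0 := by
      rw [Ne, C_eq_zero]; positivity
    have hs : C ((n : ℚ) + 2) * (C ((n + 1 : ℕ) : ℚ) * schroederPoly (n + 1)) =
        C ((n : ℚ) + 1) * ((2 * X + 1) * (C (n : ℚ) * schroederPoly n) + 2 * delannoyPoly n) := by
      rw [← schroederPoly_succ]; push_cast; ring
    have cA := congrArg (fun P : ℚ[X] => P.comp (X * (X + 1))) (delannoySqPoly_succ n)
    have cB := congrArg (fun P : ℚ[X] => P.comp (X * (X + 1))) (crossPoly_succ n)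
    have cE := congrArg (fun P : ℚ[X] => P.comp (X * (X + 1))) (schroederSqPoly_succ n)
    simp only [add_comp, mul_comp, C_comp, X_comp, ← hA, ← hB, ← hE] at cA cB cE
    simp only [map_ofNat, map_pow] at cA cB cE
    have hd := delannoyPoly_succ n
    generalize C ((n + 1 : ℕ) : ℚ) * schroederPoly (n + 1) = S at *
    generalize C (n : ℚ) * schroederPoly n = s at *
    generalize delannoyPoly n = d at *
    generalize delannoyPoly (n + 1) = D at *
    refine ⟨?_, ?_, ?_⟩
    · rw [cA, hd]; ring
    · apply mul_left_cancel₀ h2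
      rw [cB, hd]
      linear_combination (2 * X + 1) * ((2 * X + 1) * d + 2 * (X * (X + 1)) * s) * hs
    · apply mul_left_cancel₀ (pow_ne_zero 2 h2)
      rw [cE, ← mul_pow, hs]
      ring

/-! ### The coefficients of W_n and the telescoping sum -/

theorem wNum_succ (n k : ℕ) (hn : 1 ≤ n) (hk : 1 ≤ k) :
    (k : ℚ) * (k + 1) * wNum n (k + 1) = (n - k) * (n + k + 1) * wNum n k := by
  obtain ⟨m, rfl⟩ := Nat.exists_eq_add_of_le' hn
  obtain ⟨j, rfl⟩ := Nat.exists_eq_add_of_le' hk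
  have h1 : ((m.choose (j + 1) : ℕ) : ℚ) * (j + 1) = m.choose j * (m - j) := by
    rcases le_or_gt j m with h | h
    · have := Nat.choose_succ_right_eq m j
      rw [← Nat.cast_sub h]
      exact_mod_cast this
    · simp [Nat.choose_eq_zero_of_lt h, Nat.choose_eq_zero_of_lt (Nat.lt_succ_of_lt h)]
  have h2 : ((m : ℚ) + j + 3) * ((m + j + 2).choose j : ℚ)
      = ((m + j + 3).choose (j + 1) : ℚ) * (j + 1) := by
    exact_mod_cast Nat.add_one_mul_choose_eq (m + j + 2) j
  have hj : (j : ℚ) + 1 ≠ 0 := by positivity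
  have e1 : m + 1 + (j + 1 + 1) = m + j + 3 := by ring
  have e2 : m + 1 + (j + 1) = m + j + 2 := by ring
  simp only [wNum, Nat.add_sub_cancel, e1, e2]
  have h3 : ((m.choose (j + 1) : ℕ) : ℚ) = m.choose j * (m - j) / (j + 1) := by
    field_simp; linear_combination h1
  have h4 : ((m + j + 3).choose (j + 1) : ℚ)
      = ((m : ℚ) + j + 3) * ((m + j + 2).choose j : ℚ) / (j + 1) := by
    field_simp; linear_combination -h2
  rw [h3, h4]
  push_cast
  have hj : (j : ℚ) + 1 + 1 ≠ 0 := by positivity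
  field_simp
  ring

theorem catalan_succ_rec (k : ℕ) :
    (k + 2) * catalan (k + 1) = 2 * (2 * k + 1) * catalan k := by
  have h1 := succ_mul_catalan_eq_centralBinom k
  have h2 := succ_mul_catalan_eq_centralBinom (k + 1)
  have h3 := Nat.succ_mul_centralBinom_succ k
  rw [← h1, ← h2] at h3
  have : 0 < k + 1 := by omega
  apply Nat.eq_of_mul_eq_mul_left this
  linarith

theorem wNum_one (n : ℕ) : wNum n 1 = 1 := by simp [wNum]

/-- Both sides are hypergeometric in k with the same ratio; this ties the coefficients of W_n to
those of D_n². -/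
theorem wNum_mul_catalan (n k : ℕ) (hn : 1 ≤ n) :
    2 * (2 * (k : ℚ) + 1) * (n * (n + 1)) * (wNum n (k + 1) * catalan k)
      = (k + 1) * delannoySqCoeff n (k + 1) := by
  induction k with
  | zero =>
    simp [wNum_one, delannoySqCoeff_succ, delannoySqCoeff_zero]; ring
  | succ k ih =>
    have h1 := wNum_succ n (k + 1) hn (by omega)
    have h2 : ((k : ℚ) + 2) * catalan (k + 1) = 2 * (2 * k + 1) * catalan k := by
      exact_mod_cast catalan_succ_rec k
    rw [delannoySqCoeff_succ]
    have h3 : delannoySqCoeff n (k + 1)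
        = 2 * (2 * (k : ℚ) + 1) * (n * (n + 1)) * (wNum n (k + 1) * catalan k) / (k + 1) := by
      field_simp; linear_combination -ih
    have h4 : (catalan (k + 1) : ℚ) = 2 * (2 * k + 1) * catalan k / (k + 2) := by
      field_simp; linear_combination h2
    push_cast at h1 ⊢
    have hk : (k : ℚ) + 1 + 1 ≠ 0 := by positivity
    have h5 : wNum n (k + 1 + 1) = ((n : ℚ) - (k + 1)) * (n + (k + 1) + 1) * wNum n (k + 1)
        / ((k + 1) * (k + 1 + 1)) := by
      field_simp; linear_combination h1
    rw [h3, h4, h5]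
    field_simp
    ring

theorem coeff_wPoly (n k : ℕ) (hn : 1 ≤ n) :
    (wPoly n).coeff k = wNum n (k + 1) * catalan k := by
  have h : wPoly n = polyOfCoeffs (n - 1) (fun k => wNum n (k + 1) * catalan k) := by
    obtain ⟨m, rfl⟩ := Nat.exists_eq_add_of_le' hn
    rw [wPoly, polyOfCoeffs, Nat.add_sub_cancel, Finset.range_eq_Ico,
      ← Finset.Ico_add_one_right_eq_Icc, ← Finset.sum_Ico_add' _ 0 (m + 1) 1]
    refine Finset.sum_congr rfl fun k _ => ?_
    rw [Nat.add_sub_cancel, C_mul_X_pow_eq_monomial]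
  rw [h, coeff_polyOfCoeffs]
  intro k hk
  simp [wNum, Nat.choose_eq_zero_of_lt hk]

theorem wPoly_succ_sub (n : ℕ) :
    C ((n : ℚ) + 2) * (C ((n : ℚ) + 1) * wPoly (n + 1) - C (n : ℚ) * wPoly n)
      = crossPoly n + C 2 * delannoySqPoly n := by
  ext k
  have h1 := wNum_mul_catalan (n + 1) k (by omega)
  have h2 : 2 * (2 * (k : ℚ) + 1) * (n + 1) * (n * (wPoly n).coeff k)
      = (k + 1) * delannoySqCoeff n (k + 1) := by
    rcases Nat.eq_zero_or_pos n with rfl | hn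
    · rw [delannoySqCoeff_eq_zero (by omega)]; simp
    · rw [coeff_wPoly n k hn, ← wNum_mul_catalan n k hn]; ring
  rw [delannoySqCoeff_succ_succ] at h1
  rw [delannoySqCoeff_succ] at h2
  simp only [coeff_add, coeff_sub, coeff_C_mul, coeff_delannoySqPoly, coeff_crossPoly, crossCoeff,
    delannoySqCoeff_succ]
  rw [coeff_wPoly (n + 1) k (by omega)]
  push_cast at h1
  have hk : 2 * (2 * (k : ℚ) + 1) ≠ 0 := by positivity
  have hn : (n : ℚ) + 1 ≠ 0 := by positivity
  have hn2 : (n : ℚ) + 1 + 1 ≠ 0 := by positivity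
  have h3 : wNum (n + 1) (k + 1) * catalan k = ((k : ℚ) + 1) * (delannoySqCoeff n k *
      (2 * (2 * (k : ℚ) + 1) * (n + 1 + k) * (n + 2 + k) / (k + 1) ^ 3))
      / (2 * (2 * (k : ℚ) + 1) * ((n + 1) * (n + 1 + 1))) := by
    rw [eq_div_iff (by positivity), ← h1]; ring
  have h4 : n * (wPoly n).coeff k = ((k : ℚ) + 1) * (delannoySqCoeff n k *
      (2 * (2 * (k : ℚ) + 1) * (n + 1 + k) * (n - k) / (k + 1) ^ 3))
      / (2 * (2 * (k : ℚ) + 1) * (n + 1)) := by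
    rw [eq_div_iff (by positivity), ← h2]; ring
  rw [h3, h4]
  field_simp
  ring

theorem sum_delannoyPoly_mul_schroederPoly (n : ℕ) :
    ∑ k ∈ Finset.range n, delannoyPoly k * schroederPoly (k + 1)
      = C (n : ℚ) * (wPoly n).comp (X * (X + 1)) := by
  induction n with
  | zero => simp
  | succ n ih =>
    have h2 : C ((n : ℚ) + 2) ≠ 0 := by
      rw [Ne, C_eq_zero]; positivity
    rw [Finset.sum_range_succ, ih]
    obtain ⟨hA, hB, -⟩ := delannoy_schroeder_quadratic n
    have h := congrArg (fun P : ℚ[X] => P.comp (X * (X + 1))) (wPoly_succ_sub n)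
    simp only [add_comp, sub_comp, mul_comp, C_comp, ← hA, ← hB] at h
    simp only [map_ofNat] at h
    have hs := schroederPoly_succ n
    apply mul_left_cancel₀ h2
    push_cast at h hs ⊢
    -- D_n times the recurrence for s_{n+1} matches the increment of n·W_n.
    linear_combination delannoyPoly n * hs - h

/-! ### Integrality of w(n,k) and W_n -/

/-- The integer `w(n,k)`, as a difference of products of binomial coefficients. -/
def wInt (n k : ℕ) : ℤ :=
  (n - 1).choose (k - 1) * (n + k).choose k - n.choose k * (n + k).choose (k - 1)

/-- The two products are (n+1)/k and n/k times C(n-1,k-1)·C(n+k,k-1), so their difference leaves the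
factor 1/k. -/
theorem wNum_eq_wInt (n k : ℕ) (hn : 1 ≤ n) (hk : 1 ≤ k) : wNum n k = wInt n k := by
  obtain ⟨m, rfl⟩ := Nat.exists_eq_add_of_le' hn
  obtain ⟨j, rfl⟩ := Nat.exists_eq_add_of_le' hk
  have h1 : ((m : ℚ) + 1) * m.choose j = (m + 1).choose (j + 1) * (j + 1) := by
    exact_mod_cast Nat.add_one_mul_choose_eq m j
  have h2 : ((m + 1 + (j + 1)).choose (j + 1) : ℚ) * (j + 1)
      = (m + 1 + (j + 1)).choose j * (m + 2) := by
    have := Nat.choose_succ_right_eq (m + 1 + (j + 1)) j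
    rw [show m + 1 + (j + 1) - j = m + 2 by omega] at this
    exact_mod_cast this
  simp only [wNum, wInt, Nat.add_sub_cancel]
  push_cast
  have h3 : ((m + 1).choose (j + 1) : ℚ) = ((m : ℚ) + 1) * m.choose j / (j + 1) := by
    field_simp; linear_combination -h1
  have h4 : ((m + 1 + (j + 1)).choose (j + 1) : ℚ)
      = (m + 1 + (j + 1)).choose j * (m + 2) / (j + 1) := by
    field_simp; linear_combination h2
  rw [h3, h4]
  field_simp
  ring

/-- The integral form of `W_n`. -/
noncomputable def wIntPoly (n : ℕ) : ℤ[X] :=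
  ∑ k ∈ Finset.Icc 1 n, C (wInt n k * (catalan (k - 1) : ℤ)) * X ^ (k - 1)

theorem wPoly_eq_map (n : ℕ) : wPoly n = (wIntPoly n).map (Int.castRingHom ℚ) := by
  rw [wPoly, wIntPoly, Polynomial.map_sum]
  refine Finset.sum_congr rfl fun k hk => ?_
  obtain ⟨h1, h2⟩ := Finset.mem_Icc.1 hk
  rw [wNum_eq_wInt n k (h1.trans h2) h1]
  simp

theorem wInt_succ (n k : ℕ) (hn : 1 ≤ n) (hk : 1 ≤ k) :
    (k : ℤ) * (k + 1) * wInt n (k + 1) = (n - k) * (n + k + 1) * wInt n k := by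
  have := wNum_succ n k hn hk
  rw [wNum_eq_wInt n k hn hk, wNum_eq_wInt n (k + 1) hn (by omega)] at this
  exact_mod_cast this

/-! ### The truncated Catalan series with exact remainder -/

/-- A truncation of (1-t)·(1-t)^(-n-2) = (1-t)^(-n-1), with its boundary term. -/
theorem one_sub_mul_sum_choose {R : Type*} [CommRing R] (t : R) (n j : ℕ) :
    (1 - t) * ∑ i ∈ Finset.range (j + 1), ((n + 1 + i).choose i : R) * t ^ i
      = ∑ i ∈ Finset.range (j + 1), ((n + i).choose i : R) * t ^ i
        - ((n + 1 + j).choose j : R) * t ^ (j + 1) := by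
  induction j with
  | zero => simp
  | succ j ih =>
    rw [Finset.sum_range_succ, Finset.sum_range_succ _ (j + 1), mul_add, ih]
    have h : ((n + 1 + (j + 1)).choose (j + 1) : R)
        = (n + 1 + j).choose j + (n + (j + 1)).choose (j + 1) := by
      rw [show n + 1 + (j + 1) = (n + 1 + j) + 1 by ring, Nat.choose_succ_succ,
        show n + (j + 1) = n + 1 + j by ring]
      push_cast; ring
    rw [h]; ring

theorem two_mul_centralBinom_eq_catalan_add (n : ℕ) :
    2 * n.centralBinom = catalan n + (2 * n + 1).choose n ∧
      (n + 1).centralBinom = 2 * (2 * n + 1).choose n ∧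
      (n + 1).centralBinom = 2 * (2 * n + 1) * catalan n := by
  have h1 := succ_mul_catalan_eq_centralBinom n
  have h2 : (n + 1).centralBinom = 2 * (2 * n + 1).choose n := by
    rw [Nat.centralBinom_eq_two_mul_choose, show 2 * (n + 1) = 2 * n + 1 + 1 by ring,
      Nat.choose_succ_succ, Nat.choose_symm_half]
    ring
  have h3 := Nat.succ_mul_centralBinom_succ n
  have h4 : (n + 1).centralBinom = 2 * (2 * n + 1) * catalan n := by
    apply Nat.eq_of_mul_eq_mul_left (Nat.succ_pos n)
    rw [Nat.succ_eq_add_one, h3, ← h1]; ring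
  refine ⟨?_, h2, h4⟩
  have h5 : (2 * n + 1).choose n = (2 * n + 1) * catalan n := by
    linarith
  rw [h5, ← h1]; ring

/-- The Catalan series c(z) = 1 + z·c(z)² takes the value 1/(x+1) at z = -x(x+1); the subtracted
term is the exact error of the partial sum. -/
theorem succ_mul_sum_catalan {R : Type*} [CommRing R] (x : R) (n : ℕ) (hn : 1 ≤ n) :
    (x + 1) * ∑ k ∈ Finset.range n, (catalan k : R) * (-(x * (x + 1))) ^ k
      = 1 - (-x) ^ n * ((1 - 2 * (x + 1)) *
          ∑ j ∈ Finset.range n, ((n + j).choose j : R) * (x + 1) ^ j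
          + (n.centralBinom : R) * (x + 1) ^ n) := by
  induction n, hn using Nat.le_induction with
  | base => simp [Nat.centralBinom]; ring
  | succ n hn ih =>
    obtain ⟨hc, hc', -⟩ := two_mul_centralBinom_eq_catalan_add n
    have hU := one_sub_mul_sum_choose (x + 1) n n
    rw [Finset.sum_range_succ _ n, mul_add, ih]
    rw [Finset.sum_range_succ (fun i => ((n + i).choose i : R) * (x + 1) ^ i),
      ← two_mul n, ← Nat.centralBinom_eq_two_mul_choose, show n + 1 + n = 2 * n + 1 by ring] at hU
    have hc1 : 2 * (n.centralBinom : R) = catalan n + (2 * n + 1).choose n := by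
      simpa using congrArg (Nat.cast : ℕ → R) hc
    rw [hc']
    push_cast
    generalize ∑ i ∈ Finset.range (n + 1), ((n + 1 + i).choose i : R) * (x + 1) ^ i = U' at *
    generalize ∑ i ∈ Finset.range n, ((n + i).choose i : R) * (x + 1) ^ i = U at *
    rw [show -(x * (x + 1)) = (-x) * (x + 1) by ring, mul_pow]
    linear_combination (-x) ^ n * (1 - 2 * (x + 1)) * hU - (-x) ^ n * (x + 1) ^ (n + 1) * hc1

/-! ### Binomials, Catalan numbers and w(p,k) modulo p² -/

section Modular

-- The model is R = ℤ/p² with m = p-1, π = p and ι k = 1/(k+1).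
variable {R : Type*} [CommRing R] {m : ℕ} {π : R} {ι : ℕ → R}

/-- The factor π reduces the claim to arithmetic mod p, where m-a is -1-a and C(-1-a,k) =
(-1)^k·C(a+k,k). -/
theorem mul_choose_sub (hm : (m : R) = π - 1) (hπ : π ^ 2 = 0)
    (hι : ∀ k, k < m → ((k : R) + 1) * ι k = 1)
    (a k : ℕ) (ha : a ≤ m) (hk : k ≤ m) :
    π * ((m - a).choose k : R) = π * ((-1) ^ k * ((a + k).choose k : R)) := by
  induction k with
  | zero => simp
  | succ k ih =>
    have h1 : ((m - a).choose (k + 1) : R) * (k + 1) = (m - a).choose k * (π - 1 - a - k) := by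
      rcases le_or_gt k (m - a) with h | h
      · have := Nat.choose_succ_right_eq (m - a) k
        have e : ((m - a - k : ℕ) : R) = π - 1 - a - k := by
          rw [Nat.cast_sub h, Nat.cast_sub ha, hm]
        rw [← e]
        exact_mod_cast congrArg (Nat.cast : ℕ → R) this
      · simp [Nat.choose_eq_zero_of_lt h, Nat.choose_eq_zero_of_lt (Nat.lt_succ_of_lt h)]
    have h2 : ((a : R) + k + 1) * (a + k).choose k = (a + (k + 1)).choose (k + 1) * (k + 1) := by
      have := congrArg (Nat.cast : ℕ → R) (Nat.add_one_mul_choose_eq (a + k) k)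
      push_cast at this
      exact this
    have h3 := hι k (by omega)
    have h4 := ih (by omega)
    rw [pow_succ]
    linear_combination (ι k * π) * h1 + ι k * (π - 1 - a - k) * h4 - (-1) ^ k * ι k * π * h2
      - π * ((m - a).choose (k + 1) + (-1) ^ k * (a + (k + 1)).choose (k + 1)) * h3
      + (-1) ^ k * ι k * (a + k).choose k * hπ

theorem choose_prime_succ (hm : (m : R) = π - 1) (hπ : π ^ 2 = 0)
    (hι : ∀ k, k < m → ((k : R) + 1) * ι k = 1) (k : ℕ) (hk : k < m) :
    ((m + 1).choose (k + 1) : R) = (-1) ^ k * (π * ι k) := by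
  have h1 := mul_choose_sub hm hπ hι 0 k (Nat.zero_le _) hk.le
  have h2 : ((m : R) + 1) * m.choose k = (m + 1).choose (k + 1) * (k + 1) := by
    exact_mod_cast congrArg (Nat.cast : ℕ → R) (Nat.add_one_mul_choose_eq m k)
  simp only [Nat.sub_zero, Nat.zero_add, Nat.choose_self, Nat.cast_one, mul_one] at h1
  rw [hm] at h2
  linear_combination -ι k * h2 + ι k * h1 - ((m + 1).choose (k + 1) : R) * hι k hk

theorem sum_inv_mul_pow (hm : (m : R) = π - 1) (hπ : π ^ 2 = 0)
    (hι : ∀ k, k < m → ((k : R) + 1) * ι k = 1) (he : Even m) (t : R) :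
    ∑ k ∈ Finset.range m, π * ι k * t ^ (k + 1) = 1 - t ^ (m + 1) - (1 - t) ^ (m + 1) := by
  have h := add_pow (-t) 1 (m + 1)
  rw [Finset.sum_range_succ, Finset.sum_range_succ'] at h
  have h2 : ∑ k ∈ Finset.range m, (-t) ^ (k + 1) * 1 ^ (m + 1 - (k + 1))
      * ((m + 1).choose (k + 1) : R) = -∑ k ∈ Finset.range m, π * ι k * t ^ (k + 1) := by
    rw [← Finset.sum_neg_distrib]
    refine Finset.sum_congr rfl fun k hk => ?_
    rw [choose_prime_succ hm hπ hι k (Finset.mem_range.1 hk), neg_pow t, one_pow]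
    have : ((-1 : R) ^ k) * (-1) ^ k = 1 := by rw [← mul_pow]; simp
    linear_combination (-t ^ (k + 1) * π * ι k) * this
  rw [h2] at h
  rw [show 1 - t = -t + 1 by ring, h, he.add_one.neg_pow]
  simp
  ring

theorem choose_add_succ (hm : (m : R) = π - 1) (hπ : π ^ 2 = 0)
    (hι : ∀ k, k < m → ((k : R) + 1) * ι k = 1) (k : ℕ) (hk : k < m) :
    ((m + (k + 1)).choose (k + 1) : R) = π * ι k := by
  induction k with
  | zero =>
    have := hι 0 hk
    simp at this
    simp [this, hm]
  | succ k ih =>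
    have h1 := hι k (by omega)
    have h2 := hι (k + 1) hk
    have h3 : ((m : R) + (k + 1) + 1) * (m + (k + 1)).choose (k + 1)
        = (m + (k + 1 + 1)).choose (k + 1 + 1) * (k + 1 + 1) := by
      exact_mod_cast congrArg (Nat.cast : ℕ → R)
        (Nat.add_one_mul_choose_eq (m + (k + 1)) (k + 1))
    rw [ih (by omega), hm] at h3
    push_cast at h2
    linear_combination -ι (k + 1) * h3 - ((m + (k + 1 + 1)).choose (k + 1 + 1) : R) * h2
      + π * ι (k + 1) * h1 + ι k * ι (k + 1) * hπ

theorem mul_inv_pred (hm : (m : R) = π - 1) (hπ : π ^ 2 = 0)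
    (hι : ∀ k, k < m → ((k : R) + 1) * ι k = 1) (k : ℕ) (hk : k + 1 = m) :
    π * ι k = -π := by
  have h := hι k (by omega)
  have h2 : (k : R) + 1 = π - 1 := by rw [← hm, ← hk]; push_cast; ring
  rw [h2] at h
  linear_combination -π * h + ι k * hπ

theorem sum_choose_add (hm : (m : R) = π - 1) (hπ : π ^ 2 = 0)
    (hι : ∀ k, k < m → ((k : R) + 1) * ι k = 1) (hm1 : 1 ≤ m) (t : R) :
    ∑ j ∈ Finset.range m, ((m + j).choose j : R) * t ^ j
      = 1 + ∑ k ∈ Finset.range m, π * ι k * t ^ (k + 1) + π * t ^ m := by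
  obtain ⟨n, rfl⟩ := Nat.exists_eq_add_of_le' hm1
  -- The right-hand sum has one more term, k = m-1, equal to -π·t^m; the last summand compensates
  -- for it.
  rw [Finset.sum_range_succ', Finset.sum_range_succ _ n, mul_inv_pred hm hπ hι n rfl]
  rw [Finset.sum_congr rfl (g := fun k => π * ι k * t ^ (k + 1)) fun k hk => by
    rw [choose_add_succ hm hπ hι k (by have := Finset.mem_range.1 hk; omega)]]
  simp
  ring

/-- In C(2p,p) = ∑ C(p,k)², every inner term is divisible by p². -/
theorem centralBinom_prime (hm : (m : R) = π - 1) (hπ : π ^ 2 = 0)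
    (hι : ∀ k, k < m → ((k : R) + 1) * ι k = 1) :
    ((m + 1).centralBinom : R) = 2 := by
  rw [Nat.centralBinom_eq_two_mul_choose, ← Nat.sum_range_choose_sq, Finset.sum_range_succ,
    Finset.sum_range_succ']
  push_cast
  rw [Finset.sum_eq_zero]
  · simp; norm_num
  · intro k hk
    rw [choose_prime_succ hm hπ hι k (Finset.mem_range.1 hk)]
    linear_combination ((-1) ^ k * ι k) ^ 2 * hπ

theorem catalan_pred_prime (hm : (m : R) = π - 1) (hπ : π ^ 2 = 0)
    (hι : ∀ k, k < m → ((k : R) + 1) * ι k = 1) (hm2 : 2 ≤ m) :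
    (catalan m : R) = -(1 + 2 * π) := by
  obtain ⟨-, -, h⟩ := two_mul_centralBinom_eq_catalan_add m
  have h1 := congrArg (Nat.cast : ℕ → R) h
  rw [centralBinom_prime hm hπ hι] at h1
  push_cast at h1
  rw [hm] at h1
  have h2 := hι 1 (by omega)
  push_cast at h2
  linear_combination ι 1 * (1 + 2 * π) * h1 - (1 + 2 * π + catalan m) * h2
    + 8 * ι 1 * (catalan m : R) * hπ

theorem wInt_one (n : ℕ) : wInt n 1 = 1 := by simp [wInt]

/-- The ratio of consecutive terms is p/((k+1)(k+2)) - 1 mod p², and partial fractions make the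
first-order terms telescope. -/
theorem wInt_prime_of_lt (hm : (m : R) = π - 1) (hπ : π ^ 2 = 0)
    (hι : ∀ k, k < m → ((k : R) + 1) * ι k = 1) (k : ℕ) (hk : k < m) :
    (wInt (m + 1) (k + 1) : R) = (-1) ^ k * (1 - π + π * ι k) := by
  induction k with
  | zero =>
    have := hι 0 hk
    simp at this
    simp [wInt_one, this]
  | succ k ih =>
    have h := congrArg (Int.cast : ℤ → R) (wInt_succ (m + 1) (k + 1) (by omega) (by omega))
    have h1 := hι k (by omega)
    have h2 := hι (k + 1) hk
    have ih := ih (by omega)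
    push_cast at h h2
    rw [hm] at h
    have h3 : ((k : R) + 1) * (k + 1 + 1) * (ι k * ι (k + 1)) = 1 := by
      linear_combination (k + 1 + 1) * ι (k + 1) * h1 + h2
    have h4 : ι k * ι (k + 1) = ι k - ι (k + 1) := by
      linear_combination ι k * h2 - ι (k + 1) * h1
    generalize (wInt (m + 1) (k + 1) : R) = w at *
    generalize (wInt (m + 1) (k + 1 + 1) : R) = w' at *
    have h5 : w' = (π * (ι k - ι (k + 1)) - 1) * w := by
      rw [← h4]
      linear_combination ι k * ι (k + 1) * h - (w + w') * h3 + ι k * ι (k + 1) * w * hπ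
    rw [h5, ih, pow_succ]
    linear_combination (-1) ^ k * (ι k - ι (k + 1)) * (ι k - 1) * hπ

theorem wInt_prime (hm : (m : R) = π - 1) (hπ : π ^ 2 = 0)
    (hι : ∀ k, k < m → ((k : R) + 1) * ι k = 1) (he : Even m) (hm1 : 1 ≤ m) :
    (wInt (m + 1) (m + 1) : R) = 2 * (1 - π) := by
  have h := wInt_succ (m + 1) m (by omega) hm1
  -- The last step of the recursion has the factor m+1 = p, not invertible in R, so it is cancelled
  -- over ℤ first.
  have h' : (m : ℤ) * wInt (m + 1) (m + 1) = 2 * wInt (m + 1) m := by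
    apply mul_left_cancel₀ (show (m : ℤ) + 1 ≠ 0 by positivity)
    push_cast at h
    linear_combination h
  have h1 := congrArg (Int.cast : ℤ → R) h'
  obtain ⟨n, rfl⟩ := Nat.exists_eq_add_of_le' hm1
  have h2 : (wInt (n + 1 + 1) (n + 1) : R) = _ :=
    wInt_prime_of_lt hm hπ hι n (by omega)
  rw [mul_inv_pred hm hπ hι n rfl] at h2
  have hn : Odd n := by
    by_contra hc
    rw [Nat.not_odd_iff_even] at hc
    exact absurd he (Nat.not_even_iff_odd.2 hc.add_one)
  rw [hn.neg_one_pow] at h2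
  simp only [Int.cast_mul, Int.cast_natCast, Int.cast_ofNat] at h1
  rw [h2, hm] at h1
  linear_combination -(1 + π) * h1 + ((wInt (n + 1 + 1) (n + 1 + 1) : R) - 4) * hπ

end Modular

/-! ### Power sums through Fibonacci-type polynomials -/

/-- The Fibonacci-type polynomial `∑_k C(n-k,k) y^k`. -/
def fibSum {R : Type*} [CommRing R] (y : R) (n : ℕ) : R :=
  ∑ k ∈ Finset.range (n + 1), ((n - k).choose k : R) * y ^ k

theorem fibSum_succ {R : Type*} [CommRing R] (y : R) (n : ℕ) :
    fibSum y (n + 1) = 1 + ∑ k ∈ Finset.range n, ((n - k).choose (k + 1) : R) * y ^ (k + 1) := by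
  rw [fibSum, Finset.sum_range_succ', Finset.sum_range_succ]
  simp [add_comm]

theorem fibSum_add_two {R : Type*} [CommRing R] (y : R) (n : ℕ) :
    fibSum y (n + 2) = fibSum y (n + 1) + y * fibSum y n := by
  rw [fibSum_succ, fibSum_succ, fibSum, add_assoc, Finset.mul_sum]
  congr 1
  rw [show ∑ k ∈ Finset.range n, ((n - k).choose (k + 1) : R) * y ^ (k + 1)
      = ∑ k ∈ Finset.range (n + 1), ((n - k).choose (k + 1) : R) * y ^ (k + 1) by
    rw [Finset.sum_range_succ]; simp, ← Finset.sum_add_distrib]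
  refine Finset.sum_congr rfl fun k hk => ?_
  rw [show n + 1 - k = (n - k) + 1 by have := Finset.mem_range.1 hk; omega, Nat.choose_succ_succ]
  push_cast
  ring

theorem pow_add_pow_eq_fibSum {R : Type*} [CommRing R] (a b y : R) (h1 : a + b = 1)
    (h2 : a * b = -y) (n : ℕ) :
    a ^ (n + 2) + b ^ (n + 2) = fibSum y (n + 2) + y * fibSum y n := by
  have hb : b = 1 - a := by linear_combination h1
  subst hb
  obtain rfl : y = -(a * (1 - a)) := by rw [h2, neg_neg]
  have f0 : fibSum (-(a * (1 - a))) 0 = 1 := by simp [fibSum]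
  have f1 : fibSum (-(a * (1 - a))) 1 = 1 := by simp [fibSum, Finset.sum_range_succ]
  induction n using Nat.twoStepInduction with
  | zero => rw [fibSum_add_two, f0, f1]; ring
  | one => rw [fibSum_add_two, fibSum_add_two, f0, f1]; ring
  | more n ih1 ih2 =>
    rw [fibSum_add_two _ (n + 2), fibSum_add_two _ n] at *
    rw [fibSum_add_two _ (n + 1), fibSum_add_two _ n] at *
    linear_combination ih2 - a * (1 - a) * ih1

/-! ### W_p(y) modulo p² -/

section Modular

variable {R : Type*} [CommRing R] {m : ℕ} {π : R} {ι : ℕ → R}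

/-- Expand a^p + b^p with a = x+1, b = -x in powers of y = -ab. Up to sign, the coefficient of
y^(k+1) is p(2k+1)/(k+1)·C_k = (2p - p/(k+1))·C_k mod p². -/
theorem pow_sub_pow_eq_sum_catalan (hm : (m : R) = π - 1) (hπ : π ^ 2 = 0)
    (hι : ∀ k, k < m → ((k : R) + 1) * ι k = 1) (he : Even m) (hm2 : 2 ≤ m) (x : R) :
    (x + 1) ^ (m + 1) - x ^ (m + 1) - 1
      = x * (x + 1) * (2 * π * ∑ k ∈ Finset.range m, (catalan k : R) * (-(x * (x + 1))) ^ k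
        - ∑ k ∈ Finset.range m, π * ι k * (catalan k : R) * (-(x * (x + 1))) ^ k) := by
  have h := pow_add_pow_eq_fibSum (x + 1) (-x) (x * (x + 1)) (by ring) (by ring) (m - 1)
  rw [show m - 1 + 2 = m + 1 by omega, he.add_one.neg_pow, fibSum_succ, fibSum,
    Nat.sub_add_cancel (by omega : 1 ≤ m)] at h
  generalize x * (x + 1) = y at *
  have h2 := hι 1 (by omega)
  -- The identities relating C(2k+1,k) to C_k carry a factor 2, removed at the end by ι 1 = 1/2.
  have key : 2 * ((x + 1) ^ (m + 1) - x ^ (m + 1) - 1)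
      = 2 * (y * (2 * π * ∑ k ∈ Finset.range m, (catalan k : R) * (-y) ^ k
        - ∑ k ∈ Finset.range m, π * ι k * (catalan k : R) * (-y) ^ k)) := by
    have e : (x + 1) ^ (m + 1) - x ^ (m + 1) - 1
        = ∑ k ∈ Finset.range m, ((m - k).choose (k + 1) : R) * y ^ (k + 1)
          + y * ∑ k ∈ Finset.range m, ((m - 1 - k).choose k : R) * y ^ k := by
      linear_combination h
    rw [e]
    simp only [Finset.mul_sum, ← Finset.sum_add_distrib, ← Finset.sum_sub_distrib]
    refine Finset.sum_congr rfl fun k hk => ?_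
    have hk := Finset.mem_range.1 hk
    have h3 : ((m : R) - k) * (m - 1 - k).choose k = (m - k).choose (k + 1) * (k + 1) := by
      have := congrArg (Nat.cast : ℕ → R) (Nat.add_one_mul_choose_eq (m - 1 - k) k)
      rw [show m - 1 - k + 1 = m - k by omega] at this
      rw [← Nat.cast_sub hk.le]
      exact_mod_cast this
    have h4 := mul_choose_sub hm hπ hι (k + 1) k (by omega) hk.le
    rw [show m - (k + 1) = m - 1 - k by omega, show k + 1 + k = 2 * k + 1 by ring] at h4
    obtain ⟨-, h5, h6⟩ := two_mul_centralBinom_eq_catalan_add k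
    rw [h5] at h6
    have h6 := congrArg (Nat.cast : ℕ → R) h6
    push_cast at h6
    have h7 := hι k hk
    rw [hm] at h3
    have h8 : 2 * (((m - k).choose (k + 1) : R) + (m - 1 - k).choose k)
        = (-1) ^ k * (4 * π - 2 * π * ι k) * catalan k := by
      linear_combination -2 * ι k * h3 + 2 * ι k * h4 + (-1) ^ k * π * ι k * h6
        - (2 * (((m - k).choose (k + 1) : R) + (m - 1 - k).choose k)
          - 4 * π * (-1) ^ k * catalan k) * h7
    rw [neg_pow y]
    linear_combination y ^ (k + 1) * h8
  push_cast at h2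
  linear_combination ι 1 * key - ((x + 1) ^ (m + 1) - x ^ (m + 1) - 1
      - (y * (2 * π * ∑ k ∈ Finset.range m, (catalan k : R) * (-y) ^ k
        - ∑ k ∈ Finset.range m, π * ι k * (catalan k : R) * (-y) ^ k))) * h2

/-- The value of the integral form of `W_n` at `y`. -/
def wValue (n : ℕ) (y : R) : R :=
  ∑ k ∈ Finset.range n, (wInt n (k + 1) : R) * (catalan k : R) * y ^ k

theorem wValue_prime (hm : (m : R) = π - 1) (hπ : π ^ 2 = 0)
    (hι : ∀ k, k < m → ((k : R) + 1) * ι k = 1) (he : Even m) (hm2 : 2 ≤ m) (y : R) :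
    wValue (m + 1) y = (1 - π) * ∑ k ∈ Finset.range m, (catalan k : R) * (-y) ^ k
      + ∑ k ∈ Finset.range m, π * ι k * (catalan k : R) * (-y) ^ k
      - 2 * (1 + π) * y ^ m := by
  rw [wValue, Finset.sum_range_succ, wInt_prime hm hπ hι he (by omega),
    catalan_pred_prime hm hπ hι hm2, Finset.mul_sum, ← Finset.sum_add_distrib]
  rw [Finset.sum_congr rfl (g := fun k => (1 - π) * ((catalan k : R) * (-y) ^ k)
    + π * ι k * (catalan k : R) * (-y) ^ k) fun k hk => by
      rw [wInt_prime_of_lt hm hπ hι k (Finset.mem_range.1 hk), neg_pow]; ring]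
  linear_combination 4 * y ^ m * hπ

theorem mul_wValue_prime (hm : (m : R) = π - 1) (hπ : π ^ 2 = 0)
    (hι : ∀ k, k < m → ((k : R) + 1) * ι k = 1) (he : Even m) (hm2 : 2 ≤ m) (x q r : R)
    (hu : IsUnit (x + 1)) (hx : x ^ m = 1 + π * q) (ht : (x + 1) ^ m = 1 + π * r) :
    x * (x + 1) * wValue (m + 1) (x * (x + 1)) = 2 * π * (x * (x + 1))
      + (2 * x + 1) * (x ^ 2 * (x ^ m - 1) - (x + 1) ^ 2 * ((x + 1) ^ m - 1)) := by
  have hW := wValue_prime hm hπ hι he hm2 (x * (x + 1))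
  have hM := pow_sub_pow_eq_sum_catalan hm hπ hι he hm2 x
  have hP := succ_mul_sum_catalan x m (by omega)
  have hc : (m.centralBinom : R) = -π := by
    have h := congrArg (Nat.cast : ℕ → R) (succ_mul_catalan_eq_centralBinom m)
    push_cast at h
    rw [catalan_pred_prime hm hπ hι hm2, hm] at h
    linear_combination -h - 2 * hπ
  rw [sum_choose_add hm hπ hι (by omega), sum_inv_mul_pow hm hπ hι he, hc, he.neg_pow,
    show 1 - (x + 1) = -x by ring, he.add_one.neg_pow, pow_succ, pow_succ, hx, ht] at hP
  rw [pow_succ, pow_succ, hx, ht] at hM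
  rw [mul_pow, hx, ht] at hW
  rw [hx, ht, hW]
  generalize ∑ k ∈ Finset.range m, (catalan k : R) * (-(x * (x + 1))) ^ k = P at *
  generalize ∑ k ∈ Finset.range m, π * ι k * (catalan k : R) * (-(x * (x + 1))) ^ k = M at *
  have hP1 : (x + 1) * P = 2 * (x + 1)
      + π * ((2 * x + 1) * (x * q - (x + 1) * r + q) + 2 * (x + 1)) := by
    grind
  -- P equals 2 modulo π, once the unit x+1 is cancelled.
  have hP2 : π * P = 2 * π := by
    apply hu.mul_left_cancel
    grind
  have hM2 : x * (x + 1) * M = π * (x * q - (x + 1) * r) + 4 * π * (x * (x + 1)) := by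
    grind
  grind

theorem wValue_prime_of_sq_eq_zero (hm : (m : R) = π - 1) (hπ : π ^ 2 = 0)
    (hι : ∀ k, k < m → ((k : R) + 1) * ι k = 1) (hm2 : 2 ≤ m) (y : R)
    (hy : y ^ 2 = 0) (hy' : π * y = 0) : wValue (m + 1) y = 1 - y := by
  obtain ⟨n, rfl⟩ := Nat.exists_eq_add_of_le' hm2
  rw [wValue, Finset.sum_range_succ', Finset.sum_range_succ', Finset.sum_eq_zero]
  · rw [wInt_prime_of_lt hm hπ hι (0 + 1) (by omega)]
    simp [wInt_one]
    linear_combination (1 - ι 1) * hy'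
  · intro k _
    rw [show y ^ (k + 1 + 1) = y ^ 2 * y ^ k by ring, hy]
    ring

end Modular

/-! ### Transfer to the p-adic integers -/

theorem map_wValue {R S : Type*} [CommRing R] [CommRing S] (f : R →+* S) (n : ℕ) (y : R) :
    f (wValue n y) = wValue n (f y) := by
  simp [wValue, map_sum]

theorem aeval_wPoly_comp {K : Type*} [Field K] [Algebra ℚ K] (n : ℕ) (x : K) :
    aeval x ((wPoly n).comp (X * (X + 1))) = wValue n (x * (x + 1)) := by
  have : wPoly n = ∑ k ∈ Finset.range n,
      C ((wInt n (k + 1) : ℚ) * (catalan k : ℚ)) * X ^ k := by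
    rw [wPoly, ← Finset.Ico_add_one_right_eq_Icc, Finset.range_eq_Ico,
      ← Finset.sum_Ico_add' _ 0 n 1]
    refine Finset.sum_congr rfl fun k hk => ?_
    have := Finset.mem_Ico.1 hk
    rw [wNum_eq_wInt n (k + 1) (by omega) (by omega), Nat.add_sub_cancel]
  rw [aeval_comp, this, wValue]
  simp [map_sum]

section Padic

variable {p : ℕ} [Fact p.Prime]

/-- The factor p is why congruences mod p³ for the sum need W_p only mod p². -/
theorem delannoySchroederSum_eq (x : ℤ_[p]) :
    delannoySchroederSum p x = (p : ℚ_[p]) * ((wValue p (x * (x + 1)) : ℤ_[p]) : ℚ_[p]) := by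
  have h := congrArg (aeval (x : ℚ_[p])) (sum_delannoyPoly_mul_schroederPoly p)
  rw [map_sum, map_mul, aeval_wPoly_comp] at h
  simp only [map_mul] at h
  rw [delannoySchroederSum, h]
  have e := map_wValue (PadicInt.Coe.ringHom (p := p)) p (x * (x + 1))
  have e' : ((wValue p (x * (x + 1)) : ℤ_[p]) : ℚ_[p]) = wValue p ((x : ℚ_[p]) * (x + 1)) := by
    rw [map_mul, map_add, map_one] at e
    exact e
  rw [e']
  simp

theorem exists_inv_zmod_sq (k : ℕ) (hk : k < p - 1) :
    ((k : ZMod (p ^ 2)) + 1) * ((k : ZMod (p ^ 2)) + 1)⁻¹ = 1 := by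
  have hp := (Fact.out : p.Prime)
  have h : Nat.Coprime (k + 1) (p ^ 2) :=
    Nat.Coprime.pow_right 2 (Nat.coprime_of_lt_prime (by omega) (by omega) hp).symm
  exact_mod_cast ZMod.coe_mul_inv_eq_one (k + 1) h

theorem toZModPow_two_eq_iff (a b : ℤ_[p]) :
    PadicInt.toZModPow 2 a = PadicInt.toZModPow 2 b ↔ (p : ℤ_[p]) ^ 2 ∣ a - b := by
  rw [← sub_eq_zero, ← map_sub, ← RingHom.mem_ker, PadicInt.ker_toZModPow,
    Ideal.mem_span_singleton]

theorem toZModPow_two_prime_sq : (PadicInt.toZModPow 2 (p : ℤ_[p])) ^ 2 = 0 := by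
  rw [← map_pow, ← map_zero (PadicInt.toZModPow 2), toZModPow_two_eq_iff, sub_zero]

theorem prime_dvd_pow_pred_sub_one {x : ℤ_[p]} (hx : ¬ (p : ℤ_[p]) ∣ x) :
    (p : ℤ_[p]) ∣ x ^ (p - 1) - 1 := by
  have key : ∀ z : ℤ_[p], (p : ℤ_[p]) ∣ z ↔ PadicInt.toZMod z = 0 := fun z => by
    rw [← RingHom.mem_ker, PadicInt.ker_toZMod, PadicInt.maximalIdeal_eq_span_p,
      Ideal.mem_span_singleton]
  rw [key] at hx ⊢
  rw [map_sub, map_pow, map_one, ZMod.pow_card_sub_one_eq_one hx, sub_self]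

theorem isUnit_of_not_prime_dvd {x : ℤ_[p]} (hx : ¬ (p : ℤ_[p]) ∣ x) : IsUnit x := by
  by_contra h
  apply hx
  have : x ∈ IsLocalRing.maximalIdeal ℤ_[p] := (IsLocalRing.mem_maximalIdeal x).2 h
  rwa [PadicInt.maximalIdeal_eq_span_p, Ideal.mem_span_singleton] at this

theorem natCast_pred_eq : ((p - 1 : ℕ) : ZMod (p ^ 2))
    = PadicInt.toZModPow 2 (p : ℤ_[p]) - 1 := by
  rw [map_natCast, Nat.cast_sub (Fact.out : p.Prime).one_le, Nat.cast_one]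

theorem sq_dvd_wValue_sub_of_dvd (hp : Odd p) {y : ℤ_[p]} (hy : (p : ℤ_[p]) ∣ y) :
    (p : ℤ_[p]) ^ 2 ∣ wValue p y - (1 - y) := by
  have hp' := (Fact.out : p.Prime)
  have hp2 : 2 ≤ p - 1 := by
    have := hp'.two_le
    obtain ⟨k, hk⟩ := hp
    omega
  rw [← toZModPow_two_eq_iff, map_wValue]
  have h := wValue_prime_of_sq_eq_zero natCast_pred_eq toZModPow_two_prime_sq
    exists_inv_zmod_sq hp2 (PadicInt.toZModPow 2 y)
    (by
      rw [← map_pow, ← map_zero (PadicInt.toZModPow 2), toZModPow_two_eq_iff, sub_zero]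
      exact pow_dvd_pow_of_dvd hy 2)
    (by
      rw [← map_mul, ← map_zero (PadicInt.toZModPow 2), toZModPow_two_eq_iff, sub_zero, sq]
      exact mul_dvd_mul_left _ hy)
  rw [Nat.sub_add_cancel hp'.one_le] at h
  rw [h, map_sub, map_one]

theorem sq_dvd_mul_wValue_sub (hp : Odd p) {x : ℤ_[p]} (hx : ¬ (p : ℤ_[p]) ∣ x)
    (hx' : ¬ (p : ℤ_[p]) ∣ x + 1) :
    (p : ℤ_[p]) ^ 2 ∣ x * (x + 1) * wValue p (x * (x + 1)) - (2 * p * (x * (x + 1))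
      + (2 * x + 1) * (x ^ 2 * (x ^ (p - 1) - 1)
        - (x + 1) ^ 2 * ((x + 1) ^ (p - 1) - 1))) := by
  have hp' := (Fact.out : p.Prime)
  have hp2 : 2 ≤ p - 1 := by
    have := hp'.two_le
    obtain ⟨k, hk⟩ := hp
    omega
  have he : Even (p - 1) := by
    obtain ⟨k, hk⟩ := hp
    exact ⟨k, by omega⟩
  obtain ⟨q, hq⟩ := prime_dvd_pow_pred_sub_one hx
  obtain ⟨r, hr⟩ := prime_dvd_pow_pred_sub_one hx'
  rw [← toZModPow_two_eq_iff]
  have h := mul_wValue_prime natCast_pred_eq toZModPow_two_prime_sq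
    exists_inv_zmod_sq he hp2 (PadicInt.toZModPow 2 x) (PadicInt.toZModPow 2 q)
    (PadicInt.toZModPow 2 r)
    (by
      have := (isUnit_of_not_prime_dvd hx').map (PadicInt.toZModPow (p := p) 2)
      rwa [map_add, map_one] at this)
    (by
      rw [← map_pow, ← map_mul, ← hq]; simp)
    (by
      rw [← map_mul, ← hr]; simp)
  rw [Nat.sub_add_cancel hp'.one_le] at h
  simp only [map_mul, map_add, map_sub, map_pow, map_one, map_wValue, map_ofNat]
  exact h

theorem padicModEq_of_dvd {m : ℕ} {a b : ℚ_[p]} {c : ℤ_[p]} (hc : (p : ℤ_[p]) ^ m ∣ c)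
    (h : a - b = c) : PadicModEq p m a b := by
  obtain ⟨z, rfl⟩ := hc
  exact ⟨z, by rw [h]; push_cast; rfl⟩

theorem delannoySchroederSum_of_dvd (hp : Odd p) (x : ℤ_[p])
    (h : (p : ℤ_[p]) ∣ x ∨ (p : ℤ_[p]) ∣ x + 1) :
    PadicModEq p 3 (delannoySchroederSum p x)
      ((p : ℚ_[p]) * (1 - (x : ℚ_[p]) * ((x : ℚ_[p]) + 1))) := by
  have hy : (p : ℤ_[p]) ∣ x * (x + 1) := h.elim (Dvd.dvd.mul_right · _) (Dvd.dvd.mul_left · _)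
  refine padicModEq_of_dvd (c := p * (wValue p (x * (x + 1)) - (1 - x * (x + 1)))) ?_ ?_
  · rw [pow_succ']
    exact mul_dvd_mul_left _ (sq_dvd_wValue_sub_of_dvd hp hy)
  · rw [delannoySchroederSum_eq]
    push_cast
    ring

theorem delannoySchroederSum_of_not_dvd (hp : Odd p) (x : ℤ_[p])
    (h : ¬ ((p : ℤ_[p]) ∣ x ∨ (p : ℤ_[p]) ∣ x + 1)) :
    PadicModEq p 3 (delannoySchroederSum p x)
      (2 * (p : ℚ_[p]) ^ 2 +
        (2 * (x : ℚ_[p]) + 1) / ((x : ℚ_[p]) * ((x : ℚ_[p]) + 1)) * (p : ℚ_[p]) ^ 2 *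
          ((x : ℚ_[p]) ^ 2 * fermatQuotient p x -
            ((x : ℚ_[p]) + 1) ^ 2 * fermatQuotient p (x + 1))) ∧
    PadicModEq p 2 (delannoySchroederSum p x) 0 := by
  have hp' := (Fact.out : p.Prime)
  obtain ⟨hx, hx'⟩ := not_or.1 h
  have hd := sq_dvd_mul_wValue_sub hp hx hx'
  have hu := (isUnit_of_not_prime_dvd hx).mul (isUnit_of_not_prime_dvd hx')
  refine ⟨?_, ?_⟩
  · obtain ⟨u, hu⟩ := hu
    obtain ⟨z, hz⟩ := hd
    have hp0 : (p : ℚ_[p]) ≠ 0 := by exact_mod_cast hp'.ne_zero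
    have hx0 : (x : ℚ_[p]) ≠ 0 := by
      rw [Ne, PadicInt.coe_eq_zero]
      rintro rfl
      exact hx (dvd_zero _)
    have hx1 : (x : ℚ_[p]) + 1 ≠ 0 := by
      rw [← PadicInt.coe_one, ← PadicInt.coe_add, Ne, PadicInt.coe_eq_zero]
      intro h0
      exact hx' (h0 ▸ dvd_zero _)
    have hv : (x : ℚ_[p]) * (x + 1) * ((↑u⁻¹ : ℤ_[p]) : ℚ_[p]) = 1 := by
      have := congrArg (fun z : ℤ_[p] => (z : ℚ_[p])) u.mul_inv
      rw [hu] at this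
      push_cast at this
      exact this
    -- The congruence is known after multiplication by x(x+1), which is a unit u here; its quotient
    -- z is divided by u.
    refine ⟨↑u⁻¹ * z, ?_⟩
    rw [delannoySchroederSum_eq]
    have hz := congrArg (fun z : ℤ_[p] => (z : ℚ_[p])) hz
    have h2 : ((2 : ℤ_[p]) : ℚ_[p]) = 2 := map_ofNat PadicInt.Coe.ringHom 2
    push_cast at hz ⊢
    rw [h2] at hz
    rw [eq_div_of_mul_eq (mul_ne_zero hx0 hx1) ((mul_comm _ _).trans hv),
      fermatQuotient, fermatQuotient]
    push_cast
    field_simp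
    linear_combination hz
  · refine padicModEq_of_dvd (c := p * wValue p (x * (x + 1))) ?_ ?_
    · rw [sq]
      apply mul_dvd_mul_left
      -- As x(x+1) is a unit, it may be restored; the resulting right-hand side is divisible by p by
      -- Fermat's little theorem.
      rw [← hu.dvd_mul_left]
      rw [← dvd_sub_left (c := 2 * p * (x * (x + 1)) + (2 * x + 1) * (x ^ 2 * (x ^ (p - 1) - 1)
        - (x + 1) ^ 2 * ((x + 1) ^ (p - 1) - 1)))]
      · exact (dvd_pow_self _ two_ne_zero).trans hd
      · refine dvd_add ((dvd_mul_left _ _).mul_right _) (Dvd.dvd.mul_left (dvd_sub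
          ((prime_dvd_pow_pred_sub_one hx).mul_left _)
          ((prime_dvd_pow_pred_sub_one hx').mul_left _)) _)
    · rw [delannoySchroederSum_eq]
      push_cast
      ring

end Padic

theorem theorem1p1 :
    (∀ n : ℕ, 1 ≤ n →
      C (1 / (n : ℚ)) * ∑ k ∈ Finset.range n, delannoyPoly k * schroederPoly (k + 1)
          = (wPoly n).comp (X * (X + 1)) ∧
      (∃ V : ℤ[X], wPoly n = V.map (Int.castRingHom ℚ)) ∧
      (∀ k : ℕ, 1 ≤ k → ∃ m : ℤ, wNum n k = (m : ℚ)) ∧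
      C (1 / (n : ℚ)) * ∑ k ∈ Finset.range n, delannoyPoly k * schroederPoly (k + 1)
          ∈ Algebra.adjoin ℤ {(X * (X + 1) : ℚ[X])}) ∧
    (∀ (p : ℕ) [Fact p.Prime], Odd p → ∀ x : ℤ_[p],
      (((p : ℤ_[p]) ∣ x ∨ (p : ℤ_[p]) ∣ x + 1) →
        PadicModEq p 3 (delannoySchroederSum p x)
          ((p : ℚ_[p]) * (1 - (x : ℚ_[p]) * ((x : ℚ_[p]) + 1)))) ∧
      (¬ ((p : ℤ_[p]) ∣ x ∨ (p : ℤ_[p]) ∣ x + 1) →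
        PadicModEq p 3 (delannoySchroederSum p x)
          (2 * (p : ℚ_[p]) ^ 2 +
            (2 * (x : ℚ_[p]) + 1) / ((x : ℚ_[p]) * ((x : ℚ_[p]) + 1)) * (p : ℚ_[p]) ^ 2 *
              ((x : ℚ_[p]) ^ 2 * fermatQuotient p x -
                ((x : ℚ_[p]) + 1) ^ 2 * fermatQuotient p (x + 1))) ∧
        PadicModEq p 2 (delannoySchroederSum p x) 0)) := by
  refine ⟨fun n hn => ?_, fun p _ hp x => ⟨delannoySchroederSum_of_dvd hp x,
    delannoySchroederSum_of_not_dvd hp x⟩⟩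
  have hn0 : (n : ℚ) ≠ 0 := by exact_mod_cast Nat.pos_iff_ne_zero.1 hn
  have h : C (1 / (n : ℚ)) * ∑ k ∈ Finset.range n, delannoyPoly k * schroederPoly (k + 1)
      = (wPoly n).comp (X * (X + 1)) := by
    rw [sum_delannoyPoly_mul_schroederPoly, ← mul_assoc, ← C_mul, one_div_mul_cancel hn0, C_1,
      one_mul]
  refine ⟨h, ⟨wIntPoly n, wPoly_eq_map n⟩, fun k hk => ⟨wInt n k, wNum_eq_wInt n k hn hk⟩, ?_⟩
  -- Since W_n has integer coefficients, the composition is the evaluation of an integer polynomial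
  -- at x(x+1).
  rw [h, wPoly_eq_map, comp, eval₂_map, RingHom.eq_intCast' (C.comp (Int.castRingHom ℚ))]
  exact aeval_mem_adjoin_singleton ℤ (X * (X + 1) : ℚ[X])
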